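/- **Theorem 8.5.** A full binary tree is a plane rooted tree in which every node has $0$ or $2$ children. Its compacted form is the directed acyclic graph obtained by traversing the tree in post-order and replacing every edge that leads to a (fringe) subtree which has already been seen during the traversal by a pointer to the existing copy of that subtree; in particular only the first leaf is kept. A *compacted binary tree* is a graph obtained in this way from some full binary tree; its *size* is the number of its internal nodes. Its *spine* is the binary tree (each node having an optional left and an optional right child) obtained by deleting all pointers and the leaf, and its *right height* is the maximal number of right edges on a path in the spine from the root to a node (it is $0$ if the spine is empty). For $k,n\ge 0$ let $c_{k,n}$ be the number of compacted binary trees of size $n$ and right height at most $k$, and let $$C_k(z)=\sum_{n\ge 0} c_{k,n}\frac{z^n}{n!}$$ be the corresponding exponential generating function, a formal power series. Let $D=\frac{d}{dz}$, let $z$ denote the operator of multiplication by $z$, let $1$ be the identity operator, and let products of operators denote composition (so that $(D\cdot z)F=\frac{d}{dz}(zF)$). Define differential operators $(M_k)_{k\ge 0}$ by $$M_0=(1-z)D-1,\qquad M_1=(1-2z)D^2-(3-z)D,$$ $$M_k=M_{k-1}\cdot D-M_{k-2}\cdot\left(D^2\cdot z-z\cdot D\right)\qquad (k\ge 2).$$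 Then, for every $k\ge 0$, $$M_k\cdot C_k=0 .$$ -/

import Mathlib

/-- Full binary trees, every node having either 0 or 2 children: `BinaryTree.nil` is a leaf,
and `BinaryTree.node () l r` is an internal node with left child `l` and right child `r`. -/
abbrev FullBinaryTree : Type := BinaryTree Unit

/-- Plane rooted DAGs with a distinguished spine. The nodes are the single leaf (node number `0`)
and the internal nodes, which are numbered `1, 2, 3, …` in post-order. An edge is either an edge
to a child (`leaf` or `node`), or a pointer to the node with a given number. The numbering is
determined by the unlabeled graph, so distinct compacted trees are distinct as unlabeled graphs. -/
inductive PointerTree : Type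
  | leaf : PointerTree
  | pointer (target : ℕ) : PointerTree
  | node (left right : PointerTree) : PointerTree

namespace PointerTree

/-- The size: the number of internal nodes. -/
def size : PointerTree → ℕ
  | leaf => 0
  | pointer _ => 0
  | node l r => size l + size r + 1

/-- The spine: delete all pointers and the leaf. What remains is a binary tree in which each node
has an optional left and an optional right child (`BinaryTree.nil` is the absence of a node). -/
def spine : PointerTree → BinaryTree Unit
  | leaf => .nil
  | pointer _ => .nil
  | node l r => .node () (spine l) (spine r)

end PointerTree

/-- The right height of a binary tree with optional children: the maximal number of right edges
on a path from the root to a node (`0` for the empty tree). -/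
def rightHeight : BinaryTree Unit → ℕ
  | .nil => 0
  | .node _ l .nil => rightHeight l
  | .node _ l (.node _ rl rr) => max (rightHeight l) (rightHeight (.node () rl rr) + 1)

/-- The global state of the UID procedure: the counter, the table that associates a unique
identifier to every pair (uid of left child, uid of right child) met so far, and whether the leaf
has already been met. -/
structure UIDState : Type where
  counter : ℕ
  table : List ((ℕ × ℕ) × ℕ)
  leafSeen : Bool

/-- The initial state: counter `0`, empty table. -/
def UIDState.init : UIDState := ⟨0, [], false⟩

/-- The UID procedure (post-order traversal) on a full binary tree. It returns the graph built
for the current subtree, the uid of the current subtree (`0` for a leaf), and the new state.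
A subtree that has already been seen is replaced by a pointer to the existing copy. -/
def uidProc : FullBinaryTree → UIDState → PointerTree × ℕ × UIDState
  | .nil, s =>
      (if s.leafSeen then .pointer 0 else .leaf, 0, { s with leafSeen := true })
  | .node _ l r, s =>
      let (cl, ul, s₁) := uidProc l s
      let (cr, ur, s₂) := uidProc r s₁
      match s₂.table.lookup (ul, ur) with
      | some v => (.pointer v, v, s₂)
      | none =>
          (.node cl cr, s₂.counter + 1,
            { s₂ with
              counter := s₂.counter + 1
              table := ((ul, ur), s₂.counter + 1) :: s₂.table })

/-- The compacted form of a full binary tree. -/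
def compaction (t : FullBinaryTree) : PointerTree := (uidProc t UIDState.init).1

/-- A compacted binary tree is a DAG computed by the UID procedure from a full binary tree. -/
def IsCompactedTree (c : PointerTree) : Prop := ∃ t : FullBinaryTree, compaction t = c

/-- The compacted trees of right height at most `k` and size `n`. -/
def compactedTrees (k n : ℕ) : Set PointerTree :=
  {c | IsCompactedTree c ∧ c.size = n ∧ rightHeight c.spine ≤ k}

/-- The number of compacted trees of right height at most `k` and size `n`; the set is finite by
`compactedTrees_finite` below. -/
noncomputable def numCompactedTrees (k n : ℕ) : ℕ := (compactedTrees k n).ncard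

/-- The exponential generating function of compacted trees of right height at most `k`. -/
noncomputable def compactedEGF (k : ℕ) : PowerSeries ℚ :=
  PowerSeries.mk fun n => (numCompactedTrees k n : ℚ) / (n.factorial : ℚ)

/-- The operator `d/dz` on formal power series. -/
noncomputable def opD : Module.End ℚ (PowerSeries ℚ) :=
  (PowerSeries.derivative ℚ : PowerSeries ℚ →ₗ[ℚ] PowerSeries ℚ)

/-- The operator of multiplication by `z` on formal power series. -/
noncomputable def opZ : Module.End ℚ (PowerSeries ℚ) :=
  LinearMap.mulLeft ℚ (PowerSeries.X : PowerSeries ℚ)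

/-- The differential operators `M_k`; products are compositions of operators. -/
noncomputable def opM : ℕ → Module.End ℚ (PowerSeries ℚ)
  | 0 => (1 - opZ) * opD - 1
  | 1 => (1 - 2 * opZ) * opD ^ 2 - (3 - opZ) * opD
  | k + 2 => opM (k + 1) * opD - opM k * (opD ^ 2 * opZ - opZ * opD)

/-- All pointers have target at most `m`. -/
def PointerTree.TargetsLE (m : ℕ) : PointerTree → Prop
  | leaf => True
  | pointer v => v ≤ m
  | node l r => l.TargetsLE m ∧ r.TargetsLE m

theorem PointerTree.TargetsLE.mono {m m' : ℕ} (h : m ≤ m') :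
    ∀ {c : PointerTree}, c.TargetsLE m → c.TargetsLE m'
  | leaf, _ => trivial
  | pointer _, hc => le_trans (show _ ≤ m from hc) h
  | node _ _, hc => ⟨hc.1.mono h, hc.2.mono h⟩

/-- The invariant of the UID procedure: in the table, children have smaller uids than parents. -/
def UIDState.Good (s : UIDState) : Prop :=
  ∀ a b v, s.table.lookup (a, b) = some v → a < v ∧ b < v ∧ v ≤ s.counter

theorem uidProc_spec (t : FullBinaryTree) : ∀ s : UIDState, s.Good →
    (uidProc t s).2.2.Good ∧
    (uidProc t s).2.1 ≤ (uidProc t s).2.2.counter ∧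
    (uidProc t s).1.TargetsLE (uidProc t s).2.2.counter ∧
    (uidProc t s).2.2.counter = s.counter + (uidProc t s).1.size ∧
    ((uidProc t s).2.2.counter = s.counter ∨
      (uidProc t s).2.1 = (uidProc t s).2.2.counter) := by
  induction t with
  | nil =>
    intro s hs
    refine ⟨hs, Nat.zero_le _, ?_, ?_, Or.inl rfl⟩
    · cases h : s.leafSeen <;> simp [uidProc, h, PointerTree.TargetsLE]
    · cases h : s.leafSeen <;> simp [uidProc, h, PointerTree.size]
  | node _ l r ihl ihr =>
    intro s hs
    obtain ⟨g1, u1, p1, c1, d1⟩ := ihl s hs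
    obtain ⟨g2, u2, p2, c2, d2⟩ := ihr _ g1
    simp only [uidProc]
    generalize uidProc l s = A at *
    obtain ⟨cl, ul, s₁⟩ := A
    generalize uidProc r s₁ = B at *
    obtain ⟨cr, ur, s₂⟩ := B
    dsimp only at *
    cases h : s₂.table.lookup (ul, ur) with
    | some v =>
      have hv := g2 _ _ _ h
      refine ⟨g2, hv.2.2, hv.2.2, ?_, Or.inl ?_⟩ <;> simp only [PointerTree.size] <;> omega
    | none =>
      refine ⟨?_, le_refl _, ⟨p1.mono (by dsimp only; omega), p2.mono (by dsimp only; omega)⟩,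
        ?_, Or.inr rfl⟩
      · intro a b v hv
        simp only [List.lookup_cons] at hv
        split at hv
        · rename_i heq
          simp only [beq_iff_eq, Prod.mk.injEq] at heq
          simp only [Option.some.injEq] at hv
          dsimp only
          omega
        · have := g2 _ _ _ hv
          dsimp only
          omega
      · simp only [PointerTree.size]
        omega

theorem PointerTree.finite_size_le (m n : ℕ) :
    {c : PointerTree | c.size ≤ n ∧ c.TargetsLE m}.Finite := by
  have base : ({leaf} ∪ pointer '' Set.Iic m : Set PointerTree).Finite :=
    (Set.finite_singleton _).union ((Set.finite_Iic m).image _)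
  induction n with
  | zero =>
    refine base.subset ?_
    rintro (_ | v | ⟨l, r⟩) ⟨h, ht⟩
    · simp
    · exact Or.inr ⟨v, ht, rfl⟩
    · simp [size] at h
  | succ n ih =>
    refine (base.union (Set.Finite.image2 node ih ih)).subset ?_
    rintro (_ | v | ⟨l, r⟩) ⟨h, ht⟩
    · simp
    · exact Or.inl (Or.inr ⟨v, ht, rfl⟩)
    · simp only [size] at h
      exact Or.inr ⟨l, ⟨by omega, ht.1⟩, r, ⟨by omega, ht.2⟩, rfl⟩

theorem compactedTrees_finite (k n : ℕ) : (compactedTrees k n).Finite := by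
  refine (PointerTree.finite_size_le n n).subset ?_
  rintro c ⟨⟨t, rfl⟩, hn, -⟩
  have hg : UIDState.init.Good := by intro a b v h; simp [UIDState.init] at h
  obtain ⟨-, -, ht, hc, -⟩ := uidProc_spec t _ hg
  have : (uidProc t UIDState.init).2.2.counter = n := by
    rw [hc, ← hn]; simp [UIDState.init, compaction]
  rw [this] at ht
  exact ⟨hn.le, ht⟩

/-! The number of graphs that can be built from a reachable state depends on the state only through
its counter `u`. A terminal child (leaf or pointer) has `u + 1` choices. A node is a left graph
followed by a right graph with one right level fewer, and its pair of identifiers must be new.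
Identifiers grow in post-order, so only two terminal children can form a recorded pair, and exactly
`u` pairs are recorded. This gives the recursion `outputCount` with correction `-u` at size one
(`ncard_outputs`).

Let `A_k` be the operator `opAppend k` on exponential generating functions in which `z ^ u / u!`
stands for counter `u`. The recursion becomes `(D - A_k) A_{k+1} = D²z - zD`
(`opD_sub_opAppend_mul`), with `A_0 = Dz`. Substituting this into the recursion for `M_k` telescopes
it to `M_k = (D - A_0)(D - A_1)⋯(D - A_k)` (`opM_succ`). Since `C_k = A_{k+1} 1`, the last factor
sends `C_k` to `(D²z - zD) 1 = 0`. -/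

/-! ### Reachable states -/

/-- Record a new pair of children in the table, under the next free identifier. -/
def UIDState.push (p : ℕ × ℕ) (s : UIDState) : UIDState :=
  { s with counter := s.counter + 1, table := (p, s.counter + 1) :: s.table }

/-- The states reached by the UID procedure: the table is a bijection from a set of pairs onto
`{1, …, counter}`, children precede parents, and nothing is recorded before the first leaf. -/
structure UIDState.Complete (s : UIDState) : Prop where
  good : s.Good
  surj : ∀ v, 1 ≤ v → v ≤ s.counter → ∃ p, s.table.lookup p = some v
  inj : ∀ p q v, s.table.lookup p = some v → s.table.lookup q = some v → p = q
  counter_eq_zero : s.leafSeen = false → s.counter = 0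

theorem UIDState.complete_init : UIDState.init.Complete where
  good := by intro a b v h; simp [UIDState.init] at h
  surj := by intro v h1 h2; simp [UIDState.init] at h2; omega
  inj := by intro p q v h; simp [UIDState.init] at h
  counter_eq_zero := fun _ => rfl

theorem UIDState.lookup_push (p q : ℕ × ℕ) (s : UIDState) :
    (s.push p).table.lookup q = if q = p then some (s.counter + 1) else s.table.lookup q := by
  simp only [UIDState.push, List.lookup_cons]
  by_cases h : q = p
  · simp [h]
  · have hb : (q == p) = false := by simpa using h
    simp [h, hb]

theorem UIDState.Complete.lookup_le {s : UIDState} (hs : s.Complete) {p : ℕ × ℕ} {v : ℕ}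
    (h : s.table.lookup p = some v) : p.1 < v ∧ p.2 < v ∧ v ≤ s.counter :=
  hs.good p.1 p.2 v h

theorem UIDState.Complete.push {s : UIDState} (hs : s.Complete) (hleaf : s.leafSeen = true)
    {p : ℕ × ℕ} (hp : s.table.lookup p = none) (h1 : p.1 ≤ s.counter) (h2 : p.2 ≤ s.counter) :
    (s.push p).Complete where
  good := by
    intro a b v h
    rw [UIDState.lookup_push] at h
    split_ifs at h with hab
    · subst hab
      simp only [Option.some.injEq] at h
      simp only [UIDState.push] at *
      omega
    · have := hs.good a b v h
      simp only [UIDState.push]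
      omega
  surj := by
    intro v hv1 hv2
    by_cases hv : v = s.counter + 1
    · exact ⟨p, by rw [UIDState.lookup_push, if_pos rfl, hv]⟩
    · obtain ⟨q, hq⟩ := hs.surj v hv1 (by simp only [UIDState.push] at hv2; omega)
      refine ⟨q, ?_⟩
      rw [UIDState.lookup_push, if_neg, hq]
      rintro rfl
      simp [hp] at hq
  inj := by
    intro q r v hq hr
    rw [UIDState.lookup_push] at hq hr
    split_ifs at hq hr with h3 h4 h4
    · rw [h3, h4]
    · have := hs.lookup_le hr
      simp only [Option.some.injEq] at hq
      omega
    · have := hs.lookup_le hq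
      simp only [Option.some.injEq] at hr
      omega
    · exact hs.inj q r v hq hr
  counter_eq_zero := by simp [UIDState.push, hleaf]

theorem UIDState.Complete.setLeafSeen {s : UIDState} (hs : s.Complete) :
    ({ s with leafSeen := true } : UIDState).Complete where
  good := hs.good
  surj := hs.surj
  inj := hs.inj
  counter_eq_zero := by simp

/-! ### Outputs of the procedure, described without the input tree -/

namespace PointerTree

/-- The identifier of the root of a compacted graph built from the state `s`, and the state
reached once the graph is built. -/
def next : PointerTree → UIDState → ℕ × UIDState
  | leaf, s => (0, { s with leafSeen := true })
  | pointer v, s => (v, s)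
  | node l r, s =>
      ((r.next (l.next s).2).2.counter + 1,
        (r.next (l.next s).2).2.push ((l.next s).1, (r.next (l.next s).2).1))

theorem next_of_size_eq_zero {s : UIDState} (hs : s.leafSeen = true) :
    ∀ {c : PointerTree}, c.size = 0 → (c.next s).2 = s
  | leaf, _ => by cases s; simp_all [next]
  | pointer _, _ => rfl
  | node _ _, h => by simp [size] at h

/-- The graph `c` is an output of the UID procedure started in the state `s`. -/
def IsOutput (c : PointerTree) (s : UIDState) : Prop := ∃ t : FullBinaryTree, (uidProc t s).1 = c

end PointerTree

open PointerTree
open Finset.HasAntidiagonal (antidiagonal mem_antidiagonal)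

theorem uidProc_node (l r : FullBinaryTree) (s : UIDState) :
    uidProc (.node () l r) s =
      match (uidProc r (uidProc l s).2.2).2.2.table.lookup
          ((uidProc l s).2.1, (uidProc r (uidProc l s).2.2).2.1) with
      | some v => (.pointer v, v, (uidProc r (uidProc l s).2.2).2.2)
      | none => (.node (uidProc l s).1 (uidProc r (uidProc l s).2.2).1,
          (uidProc r (uidProc l s).2.2).2.2.counter + 1,
          (uidProc r (uidProc l s).2.2).2.2.push
            ((uidProc l s).2.1, (uidProc r (uidProc l s).2.2).2.1)) := rfl

/-- The graph alone determines the root identifier and the final state, so counting outputs never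
needs the input trees. The delicate case is a table hit, where the children's graphs are discarded:
the state must then be unchanged. -/
theorem uidProc_next (t : FullBinaryTree) : ∀ s : UIDState, s.Complete →
    (uidProc t s).2 = (uidProc t s).1.next s ∧ (uidProc t s).2.2.Complete ∧
      (uidProc t s).2.2.leafSeen = true := by
  induction t with
  | nil =>
    intro s hs
    refine ⟨?_, hs.setLeafSeen, rfl⟩
    cases h : s.leafSeen
    · simp [uidProc, h, next]
    · cases s
      simp_all [uidProc, next]
  | node _ l r ihl ihr =>
    intro s hs
    obtain ⟨n1, k1, f1⟩ := ihl s hs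
    obtain ⟨n2, k2, f2⟩ := ihr _ k1
    obtain ⟨-, u1, -, c1, d1⟩ := uidProc_spec l s hs.good
    obtain ⟨-, u2, -, c2, d2⟩ := uidProc_spec r _ k1.good
    rw [uidProc_node]
    generalize uidProc l s = A at *
    obtain ⟨cl, ul, s₁⟩ := A
    dsimp only at *
    generalize uidProc r s₁ = B at *
    obtain ⟨cr, ur, s₂⟩ := B
    dsimp only at *
    cases h : s₂.table.lookup (ul, ur) with
    | some v =>
      have hv := k2.lookup_le h
      refine ⟨?_, k2, f2⟩
      -- A nonterminal child would make one of the two identifiers equal to the current counter, too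
      -- large for a recorded pair. Hence both children are terminal, and the hit was already in
      -- `s`, whose counter is positive.
      have hleaf : s.leafSeen = true := by
        by_contra hcon
        have := hs.counter_eq_zero (by simpa using hcon)
        dsimp only at *
        omega
      have e1 : s₁ = s := by
        have := next_of_size_eq_zero hleaf (c := cl) (by dsimp only at *; omega)
        rwa [← n1] at this
      have e2 : s₂ = s₁ := by
        have := next_of_size_eq_zero f1 (c := cr) (by dsimp only at *; omega)
        rwa [← n2] at this
      simp [next, e2, e1]
    | none =>
      refine ⟨?_, k2.push f2 h (by dsimp only; omega) u2, f2⟩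
      simp [next, ← n1, ← n2]

namespace PointerTree.IsOutput

variable {s : UIDState} {c l r : PointerTree}

theorem complete_next (h : c.IsOutput s) (hs : s.Complete) : (c.next s).2.Complete := by
  obtain ⟨t, rfl⟩ := h
  rw [← (uidProc_next t s hs).1]
  exact (uidProc_next t s hs).2.1

theorem leafSeen_next (h : c.IsOutput s) (hs : s.Complete) : (c.next s).2.leafSeen = true := by
  obtain ⟨t, rfl⟩ := h
  rw [← (uidProc_next t s hs).1]
  exact (uidProc_next t s hs).2.2

theorem counter_next (h : c.IsOutput s) (hs : s.Complete) :
    (c.next s).2.counter = s.counter + c.size := by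
  obtain ⟨t, rfl⟩ := h
  rw [← (uidProc_next t s hs).1]
  exact (uidProc_spec t s hs.good).2.2.2.1

theorem targetsLE (h : c.IsOutput s) (hs : s.Complete) : c.TargetsLE (s.counter + c.size) := by
  obtain ⟨t, rfl⟩ := h
  rw [← (uidProc_spec t s hs.good).2.2.2.1]
  exact (uidProc_spec t s hs.good).2.2.1

/-- In post-order the root is numbered last. -/
theorem uid_eq_counter (h : c.IsOutput s) (hs : s.Complete) (hc : c.size ≠ 0) :
    (c.next s).1 = (c.next s).2.counter := by
  have h1 := h.counter_next hs
  obtain ⟨t, rfl⟩ := h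
  have h2 := (uidProc_spec t s hs.good).2.2.2.2
  rw [(uidProc_next t s hs).1] at h2
  omega

/-- Only two terminal children can form a pair that is already in the table. -/
theorem lookup_eq_none (hl : l.IsOutput s) (hr : r.IsOutput (l.next s).2) (hs : s.Complete)
    (h : l.size + r.size ≠ 0) :
    (r.next (l.next s).2).2.table.lookup ((l.next s).1, (r.next (l.next s).2).1) = none := by
  have hs1 := hl.complete_next hs
  have hs2 := hr.complete_next hs1
  have c2 := hr.counter_next hs1
  rw [Option.eq_none_iff_forall_ne_some]
  intro v hv
  have hlt := hs2.lookup_le hv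
  dsimp only at hlt
  -- The last nonterminal child carries the current counter as its identifier, whereas recorded
  -- children lie strictly below it.
  by_cases h2 : r.size = 0
  · have := hl.uid_eq_counter hs (by omega)
    omega
  · have := hr.uid_eq_counter hs1 h2
    omega

end PointerTree.IsOutput

theorem PointerTree.isOutput_leaf_iff {s : UIDState} : leaf.IsOutput s ↔ s.leafSeen = false := by
  constructor
  · rintro ⟨t, ht⟩
    cases t with
    | nil => by_contra h; simp_all [uidProc]
    | node u l r =>
      rw [uidProc_node] at ht
      split at ht <;> simp at ht
  · intro h
    exact ⟨.nil, by simp [uidProc, h]⟩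

namespace UIDState.Complete

variable {s : UIDState} {l r : PointerTree}

theorem isOutput_node_iff (hs : s.Complete) : (node l r).IsOutput s ↔
    l.IsOutput s ∧ r.IsOutput (l.next s).2 ∧
      (r.next (l.next s).2).2.table.lookup ((l.next s).1, (r.next (l.next s).2).1) = none := by
  constructor
  · rintro ⟨t, ht⟩
    cases t with
    | nil => cases h : s.leafSeen <;> simp [uidProc, h] at ht
    | node u tl tr =>
      rw [uidProc_node] at ht
      have n1 := uidProc_next tl s hs
      have n2 := uidProc_next tr _ n1.2.1
      split at ht
      · simp at ht
      · rename_i hlook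
        simp only [node.injEq] at ht
        obtain ⟨rfl, rfl⟩ := ht
        rw [← n1.1, ← n2.1]
        exact ⟨⟨tl, rfl⟩, ⟨tr, rfl⟩, hlook⟩
  · rintro ⟨⟨tl, rfl⟩, ⟨tr, htr⟩, hlook⟩
    have n1 := uidProc_next tl s hs
    have n2 := uidProc_next tr _ n1.2.1
    rw [← n1.1] at htr hlook
    subst htr
    rw [← n2.1] at hlook
    exact ⟨.node () tl tr, by rw [uidProc_node, hlook]⟩

/-- Unfold the identifier `v` through the table: its children have smaller identifiers, so by
induction they come from trees that compact to pointers and leave the state unchanged. -/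
theorem isOutput_pointer (hs : s.Complete) (hleaf : s.leafSeen = true) (v : ℕ)
    (hv : v ≤ s.counter) : (pointer v).IsOutput s := by
  induction v using Nat.strong_induction_on with
  | _ v ih =>
    obtain rfl | hpos := Nat.eq_zero_or_pos v
    · exact ⟨.nil, by simp [uidProc, hleaf]⟩
    · obtain ⟨p, hp⟩ := hs.surj v hpos hv
      have hlt := hs.lookup_le hp
      obtain ⟨tl, hl⟩ := ih p.1 hlt.1 (by omega)
      obtain ⟨tr, hr⟩ := ih p.2 hlt.2.1 (by omega)
      have n1 := (uidProc_next tl s hs).1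
      have n2 := (uidProc_next tr s hs).1
      rw [hl] at n1
      rw [hr] at n2
      refine ⟨.node () tl tr, ?_⟩
      rw [uidProc_node, n1]
      simp only [next]
      rw [n2]
      simp only [next]
      rw [hp]

theorem isOutput_pointer_iff (hs : s.Complete) (v : ℕ) :
    (pointer v).IsOutput s ↔ s.leafSeen = true ∧ v ≤ s.counter := by
  refine ⟨fun h => ?_, fun h => hs.isOutput_pointer h.1 v h.2⟩
  exact ⟨h.leafSeen_next hs, h.targetsLE hs⟩

end UIDState.Complete

/-! ### Right levels and the counting recursion -/

/-- The maximal number of nodes reached on a spine path by taking right edges, counting the root: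
`0` for an empty spine, and one more than the right height otherwise. -/
def PointerTree.rightLevels : PointerTree → ℕ
  | leaf => 0
  | pointer _ => 0
  | node l r => max l.rightLevels (r.rightLevels + 1)

/-- Giving the empty spine its own level `0` removes the case split on the right child, hence the
shift by one. -/
theorem PointerTree.rightHeight_spine_le_iff (k : ℕ) (c : PointerTree) :
    rightHeight c.spine ≤ k ↔ c.rightLevels ≤ k + 1 := by
  induction c generalizing k with
  | leaf => simp [spine, rightHeight, rightLevels]
  | pointer v => simp [spine, rightHeight, rightLevels]
  | node l r ihl ihr =>
    cases r with
    | leaf => simp [spine, rightHeight, rightLevels, ihl]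
    | pointer v => simp [spine, rightHeight, rightLevels, ihl]
    | node rl rr =>
      cases k with
      | zero =>
        have hpos : 0 < (node rl rr).rightLevels := by simp [rightLevels]
        have hl : (node l (node rl rr)).rightLevels =
          max l.rightLevels ((node rl rr).rightLevels + 1) := rfl
        have hh : rightHeight (node l (node rl rr)).spine =
          max (rightHeight l.spine) (rightHeight (node rl rr).spine + 1) := by
            simp [spine, rightHeight]
        rw [hl, hh]
        omega
      | succ k =>
        have hr := ihr k
        have hh : rightHeight (node l (node rl rr)).spine =
          max (rightHeight l.spine) (rightHeight (node rl rr).spine + 1) := by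
            simp [spine, rightHeight]
        have hl : (node l (node rl rr)).rightLevels =
          max l.rightLevels ((node rl rr).rightLevels + 1) := rfl
        rw [hh, hl, max_le_iff, max_le_iff, ihl, Nat.add_le_add_iff_right, hr,
          Nat.add_le_add_iff_right]

/-- The number of graphs with `n` internal nodes and at most `k` right levels which the UID
procedure can build from a complete state with counter `u`. -/
def outputCount : ℕ → ℕ → ℕ → ℚ
  | _, 0, u => u + 1
  | 0, _ + 1, _ => 0
  | k + 1, n + 1, u =>
      (∑ i : Fin (n + 1), outputCount (k + 1) i u * outputCount k (n - i) (u + i)) -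
        if n = 0 then (u : ℚ) else 0
  termination_by k n => (k, n)

theorem outputCount_zero (k u : ℕ) : outputCount k 0 u = u + 1 := by
  rw [outputCount]

theorem outputCount_zero_succ (n u : ℕ) : outputCount 0 (n + 1) u = 0 := by
  rw [outputCount]

theorem outputCount_succ_succ (k n u : ℕ) : outputCount (k + 1) (n + 1) u =
    (∑ p ∈ antidiagonal n, outputCount (k + 1) p.1 u * outputCount k p.2 (u + p.1)) -
      if n = 0 then (u : ℚ) else 0 := by
  rw [outputCount, Finset.Nat.sum_antidiagonal_eq_sum_range_succ_mk, Finset.sum_range]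

/-- The outputs of the UID procedure from the state `s`, of size `n` with at most `k` right
levels. -/
def outputs (k n : ℕ) (s : UIDState) : Set PointerTree :=
  {c | c.IsOutput s ∧ c.size = n ∧ c.rightLevels ≤ k}

theorem outputs_finite {s : UIDState} (hs : s.Complete) (k n : ℕ) : (outputs k n s).Finite := by
  refine (finite_size_le (s.counter + n) n).subset ?_
  rintro c ⟨h, rfl, -⟩
  exact ⟨le_rfl, h.targetsLE hs⟩

theorem outputs_size_zero_of_leafSeen {s : UIDState} (hs : s.Complete)
    (hleaf : s.leafSeen = true) (k : ℕ) :
    outputs k 0 s = pointer '' (Finset.range (s.counter + 1) : Set ℕ) := by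
  ext c
  cases c with
  | leaf => simp [outputs, isOutput_leaf_iff, hleaf]
  | pointer v =>
    simp [outputs, hs.isOutput_pointer_iff, hleaf, size, rightLevels]
  | node l r => simp [outputs, size]

theorem outputs_size_zero_of_not_leafSeen {s : UIDState} (hs : s.Complete)
    (hleaf : s.leafSeen = false) (k : ℕ) : outputs k 0 s = {leaf} := by
  ext c
  cases c with
  | leaf => simp [outputs, isOutput_leaf_iff, hleaf, size, rightLevels]
  | pointer v => simp [outputs, hs.isOutput_pointer_iff, hleaf]
  | node l r => simp [outputs, size]

theorem PointerTree.pointer_injective : Function.Injective pointer := fun _ _ h => by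
  simpa using h

/-- After the first leaf, the choices are pointers to `0, …, counter`; before it there is only the
leaf, and the counter is `0`. -/
theorem ncard_outputs_size_zero {s : UIDState} (hs : s.Complete) (k : ℕ) :
    (outputs k 0 s).ncard = s.counter + 1 := by
  cases hleaf : s.leafSeen
  · rw [outputs_size_zero_of_not_leafSeen hs hleaf, Set.ncard_singleton,
      hs.counter_eq_zero hleaf]
  · rw [outputs_size_zero_of_leafSeen hs hleaf, Set.ncard_image_of_injective _ pointer_injective,
      Set.ncard_coe_finset, Finset.card_range]

theorem outputs_zero_succ (n : ℕ) (s : UIDState) : outputs 0 (n + 1) s = ∅ := by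
  ext c
  cases c <;> simp [outputs, size, rightLevels]

/-- A table of a complete state holds exactly `counter` pairs. -/
theorem UIDState.Complete.card_lookup_eq_none {s : UIDState} (hs : s.Complete) :
    (((Finset.range (s.counter + 1) ×ˢ Finset.range (s.counter + 1)).filter
      fun p => s.table.lookup p = none).card : ℚ) =
      ((s.counter : ℚ) + 1) * (s.counter + 1) - s.counter := by
  set B := Finset.range (s.counter + 1) ×ˢ Finset.range (s.counter + 1)
  have hsum := Finset.card_filter_add_card_filter_not (s := B) fun p => s.table.lookup p = none
  have hbad : (B.filter fun p => ¬ s.table.lookup p = none).card = s.counter := by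
    have hcard : (Finset.Icc 1 s.counter).card = s.counter := by simp
    rw [← hcard]
    -- Lookup is a bijection from recorded pairs to `{1, …, counter}`.
    refine Finset.card_bij (fun p _ => (s.table.lookup p).getD 0) ?_ ?_ ?_
    · intro p hp
      obtain ⟨v, hv⟩ := Option.ne_none_iff_exists'.1 (Finset.mem_filter.1 hp).2
      have := hs.lookup_le hv
      simp only [hv, Option.getD_some, Finset.mem_Icc]
      omega
    · intro p hp q hq hpq
      obtain ⟨v, hv⟩ := Option.ne_none_iff_exists'.1 (Finset.mem_filter.1 hp).2
      obtain ⟨w, hw⟩ := Option.ne_none_iff_exists'.1 (Finset.mem_filter.1 hq).2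
      simp only [hv, hw, Option.getD_some] at hpq
      subst hpq
      exact hs.inj p q v hv hw
    · intro v hv
      rw [Finset.mem_Icc] at hv
      obtain ⟨p, hp⟩ := hs.surj v hv.1 hv.2
      have := hs.lookup_le hp
      refine ⟨p, ?_, by simp [hp]⟩
      simp only [B, Finset.mem_filter, Finset.mem_product, Finset.mem_range, hp]
      refine ⟨by omega, by simp⟩
  have hB : B.card = (s.counter + 1) * (s.counter + 1) := by simp [B]
  rw [hbad, hB] at hsum
  have : ((B.filter fun p => s.table.lookup p = none).card : ℚ) + s.counter =
      (s.counter + 1) * (s.counter + 1) := by exact_mod_cast hsum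
  linarith

/-- Both children are terminal, so the graph amounts to an unrecorded pair of identifiers. The right
child is always a pointer, since the left one has already met a leaf. -/
theorem ncard_outputs_succ_one {s : UIDState} (hs : s.Complete) (k : ℕ) :
    ((outputs (k + 1) 1 s).ncard : ℚ) =
      ((s.counter : ℚ) + 1) * (s.counter + 1) - s.counter := by
  rw [← hs.card_lookup_eq_none]
  set B := (Finset.range (s.counter + 1) ×ˢ Finset.range (s.counter + 1)).filter
    fun p => s.table.lookup p = none
  let first : ℕ → PointerTree := fun a => if s.leafSeen then pointer a else leaf
  have himage : outputs (k + 1) 1 s =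
      (fun p : ℕ × ℕ => node (first p.1) (pointer p.2)) '' (B : Set (ℕ × ℕ)) := by
    ext c
    cases c with
    | leaf => simp [outputs, size]
    | pointer v => simp [outputs, size]
    | node l r =>
      cases hleaf : s.leafSeen with
      | true =>
        cases l <;> cases r <;>
          simp [outputs, hs.isOutput_node_iff, size, first, hleaf, next, isOutput_leaf_iff,
            hs.isOutput_pointer_iff, rightLevels, B, and_assoc]
      | false =>
        have h0 := hs.counter_eq_zero hleaf
        have hptr (v : ℕ) : (pointer v).IsOutput
            { counter := 0, table := s.table, leafSeen := true } ↔ v = 0 := by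
          have h := hs.setLeafSeen.isOutput_pointer_iff v
          simpa [h0] using h
        cases l <;> cases r <;>
          simp [outputs, hs.isOutput_node_iff, size, first, hleaf, next, isOutput_leaf_iff,
            hs.isOutput_pointer_iff, hptr, rightLevels, B, h0]
  have hinj : Set.InjOn (fun p : ℕ × ℕ => node (first p.1) (pointer p.2)) (B : Set (ℕ × ℕ)) := by
    rintro ⟨a, b⟩ hp ⟨a', b'⟩ hq h
    simp only [B, Finset.coe_filter, Finset.mem_product, Finset.mem_range,
      Set.mem_ofPred_eq] at hp hq
    cases hleaf : s.leafSeen with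
    | true => simpa [first, hleaf] using h
    | false =>
      have h0 := hs.counter_eq_zero hleaf
      simp only [Prod.mk.injEq]
      omega
  rw [himage, hinj.ncard_image, Set.ncard_coe_finset]

/-- Above size one, a graph is an arbitrary pair of consecutive outputs. -/
theorem ncard_outputs_succ_succ {s : UIDState} (hs : s.Complete) (k n : ℕ) (hn : n ≠ 0)
    (f : ℕ → ℕ → ℚ)
    (hf : ∀ j, ∀ s' : UIDState, s'.Complete → ((outputs k j s').ncard : ℚ) = f j s'.counter) :
    ((outputs (k + 1) (n + 1) s).ncard : ℚ) = ∑ p ∈ antidiagonal n,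
      ((outputs (k + 1) p.1 s).ncard : ℚ) * f p.2 (s.counter + p.1) := by
  classical
  let A (i : ℕ) : Finset PointerTree := (outputs_finite hs (k + 1) i).toFinset
  have hfin (i : ℕ) (l : A i) (j : ℕ) : (outputs k j (l.1.next s).2).Finite :=
    outputs_finite (((Set.Finite.mem_toFinset _).1 l.2).1.complete_next hs) k j
  -- The right graphs range over a set that depends on the left graph, but its cardinality depends
  -- only on the left size.
  let S (p : ℕ × ℕ) : Finset PointerTree := (A p.1).attach.biUnion fun l =>
    (hfin p.1 l p.2).toFinset.image (node l.1)
  have hS : (outputs_finite hs (k + 1) (n + 1)).toFinset = (antidiagonal n).biUnion S := by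
    ext c
    simp only [Set.Finite.mem_toFinset, Finset.mem_biUnion, mem_antidiagonal, S,
      Finset.mem_attach, true_and, Finset.mem_image, Subtype.exists, A]
    constructor
    · rintro ⟨h1, h2, h3⟩
      cases c with
      | leaf => simp [size] at h2
      | pointer v => simp [size] at h2
      | node l r =>
        simp only [size] at h2
        simp only [rightLevels, max_le_iff, Nat.add_le_add_iff_right] at h3
        rw [hs.isOutput_node_iff] at h1
        exact ⟨(l.size, r.size), by dsimp only; omega, l, ⟨h1.1, rfl, h3.1⟩, r,
          ⟨h1.2.1, rfl, h3.2⟩, rfl⟩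
    · rintro ⟨⟨i, j⟩, hij, l, hl, r, hr, rfl⟩
      obtain ⟨l1, l2, l3⟩ := hl
      obtain ⟨r1, r2, r3⟩ := hr
      dsimp only at *
      refine ⟨hs.isOutput_node_iff.2 ⟨l1, r1, l1.lookup_eq_none r1 hs (by omega)⟩, ?_, ?_⟩
      · simp only [size]
        omega
      · simp only [rightLevels, max_le_iff, Nat.add_le_add_iff_right]
        exact ⟨l3, r3⟩
  have hcard (p : ℕ × ℕ) : ((S p).card : ℚ) =
      ((outputs (k + 1) p.1 s).ncard : ℚ) * f p.2 (s.counter + p.1) := by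
    rw [Finset.card_biUnion]
    · rw [Nat.cast_sum, Finset.sum_congr rfl (g := fun _ => f p.2 (s.counter + p.1))]
      · rw [Finset.sum_const, Finset.card_attach, nsmul_eq_mul,
          Set.ncard_eq_toFinset_card _ (outputs_finite hs (k + 1) p.1)]
      · rintro ⟨l, hl⟩ -
        have hl' := (Set.Finite.mem_toFinset _).1 hl
        rw [Finset.card_image_of_injective _ (fun _ _ h => by simpa using h),
          ← Set.ncard_eq_toFinset_card _ (hfin p.1 ⟨l, hl⟩ p.2),
          hf _ _ (hl'.1.complete_next hs), hl'.1.counter_next hs, hl'.2.1]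
    · rintro ⟨l, hl⟩ - ⟨l', hl'⟩ - hne
      rw [Function.onFun, Finset.disjoint_left]
      intro c hc hc'
      simp only [Finset.mem_image] at hc hc'
      obtain ⟨r, -, rfl⟩ := hc
      obtain ⟨r', -, h⟩ := hc'
      simp only [node.injEq] at h
      exact hne (Subtype.ext h.1.symm)
  rw [Set.ncard_eq_toFinset_card _ (outputs_finite hs (k + 1) (n + 1)), hS, Finset.card_biUnion,
    Nat.cast_sum]
  · exact Finset.sum_congr rfl fun p _ => hcard p
  · rintro ⟨i, j⟩ hp ⟨i', j'⟩ hq hne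
    rw [Function.onFun, Finset.disjoint_left]
    intro c hc hc'
    simp only [S, Finset.mem_biUnion, Finset.mem_attach, true_and, Finset.mem_image,
      Subtype.exists, A, Set.Finite.mem_toFinset] at hc hc'
    obtain ⟨l, hl, r, hr, rfl⟩ := hc
    obtain ⟨l', hl', r', hr', h⟩ := hc'
    simp only [node.injEq] at h
    obtain ⟨rfl, rfl⟩ := h
    exact hne (Prod.ext (hl.2.1.symm.trans hl'.2.1) (hr.2.1.symm.trans hr'.2.1))

/-- The outer induction on levels handles right children, the inner one on size handles left
children. -/
theorem ncard_outputs (k : ℕ) : ∀ (n : ℕ) (s : UIDState), s.Complete →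
    ((outputs k n s).ncard : ℚ) = outputCount k n s.counter := by
  induction k with
  | zero =>
    intro n s hs
    cases n with
    | zero => rw [ncard_outputs_size_zero hs, outputCount_zero]; push_cast; rfl
    | succ n => rw [outputs_zero_succ, outputCount_zero_succ]; simp
  | succ k ihk =>
    intro n
    induction n using Nat.strong_induction_on with
    | _ n ihn =>
      intro s hs
      rcases n with _ | _ | n
      · rw [ncard_outputs_size_zero hs, outputCount_zero]; push_cast; rfl
      · rw [ncard_outputs_succ_one hs, outputCount_succ_succ]
        simp [outputCount_zero]
      · rw [ncard_outputs_succ_succ hs k (n + 1) (by omega) _ ihk, outputCount_succ_succ,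
          if_neg (by omega), sub_zero]
        refine Finset.sum_congr rfl fun p hp => ?_
        rw [mem_antidiagonal] at hp
        rw [ihn p.1 (by omega) s hs]

theorem numCompactedTrees_eq (k n : ℕ) :
    (numCompactedTrees k n : ℚ) = outputCount (k + 1) n 0 := by
  have h : compactedTrees k n = outputs (k + 1) n UIDState.init := by
    ext c
    simp only [compactedTrees, outputs, Set.mem_ofPred_eq, rightHeight_spine_le_iff]
    rfl
  rw [numCompactedTrees, h, ncard_outputs _ _ _ UIDState.complete_init]
  rfl

/-! ### Translation into operators on power series -/

/-- The coefficient of `z ^ n / n!` in a power series. -/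
noncomputable def egfCoeff (n : ℕ) (f : PowerSeries ℚ) : ℚ := n.factorial * f.coeff n

theorem egfCoeff_ext {f g : PowerSeries ℚ} (h : ∀ n, egfCoeff n f = egfCoeff n g) : f = g := by
  ext n
  exact mul_left_cancel₀ (Nat.cast_ne_zero.2 n.factorial_ne_zero) (h n)

theorem egfCoeff_add (n : ℕ) (f g : PowerSeries ℚ) :
    egfCoeff n (f + g) = egfCoeff n f + egfCoeff n g := by
  simp [egfCoeff, mul_add]

theorem egfCoeff_sub (n : ℕ) (f g : PowerSeries ℚ) :
    egfCoeff n (f - g) = egfCoeff n f - egfCoeff n g := by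
  simp [egfCoeff, mul_sub]

theorem egfCoeff_opD (n : ℕ) (f : PowerSeries ℚ) : egfCoeff n (opD f) = egfCoeff (n + 1) f := by
  have h : (opD f).coeff n = f.coeff (n + 1) * (n + 1) := PowerSeries.coeff_derivative f n
  rw [egfCoeff, egfCoeff, h, Nat.factorial_succ]
  push_cast
  ring

theorem egfCoeff_opZ_zero (f : PowerSeries ℚ) : egfCoeff 0 (opZ f) = 0 := by
  simp [egfCoeff, opZ]

theorem egfCoeff_opZ_succ (n : ℕ) (f : PowerSeries ℚ) :
    egfCoeff (n + 1) (opZ f) = (n + 1) * egfCoeff n f := by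
  simp only [egfCoeff, opZ, LinearMap.mulLeft_apply, PowerSeries.coeff_succ_X_mul,
    Nat.factorial_succ]
  push_cast
  ring

theorem egfCoeff_opZ_opD (n : ℕ) (f : PowerSeries ℚ) :
    egfCoeff n (opZ (opD f)) = n * egfCoeff n f := by
  cases n with
  | zero => simp [egfCoeff_opZ_zero]
  | succ n => rw [egfCoeff_opZ_succ, egfCoeff_opD]; push_cast; ring

/-- The operator that appends an output of the UID procedure with at most `k` right levels:
it maps `z ^ u / u!` to the sum of `outputCount k n u * z ^ (u + n) / (u + n)!`. -/
noncomputable def opAppend (k : ℕ) : Module.End ℚ (PowerSeries ℚ) where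
  toFun f := PowerSeries.mk fun N =>
    (∑ p ∈ antidiagonal N, outputCount k p.2 p.1 * egfCoeff p.1 f) / N.factorial
  map_add' f g := by
    ext N
    simp only [egfCoeff, map_add, PowerSeries.coeff_mk, mul_add, Finset.sum_add_distrib, add_div]
  map_smul' a f := by
    ext N
    simp only [egfCoeff, PowerSeries.coeff_smul, PowerSeries.coeff_mk, smul_eq_mul,
      RingHom.id_apply, ← mul_div_assoc, Finset.mul_sum]
    congr 1
    exact Finset.sum_congr rfl fun p _ => by ring

theorem egfCoeff_opAppend (k N : ℕ) (f : PowerSeries ℚ) : egfCoeff N (opAppend k f) =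
    ∑ p ∈ antidiagonal N, outputCount k p.2 p.1 * egfCoeff p.1 f := by
  have h : ((N.factorial : ℕ) : ℚ) ≠ 0 := Nat.cast_ne_zero.2 N.factorial_ne_zero
  rw [egfCoeff]
  simp only [opAppend, LinearMap.coe_mk, AddHom.coe_mk, PowerSeries.coeff_mk]
  field_simp

/-- With no right level only a terminal can be appended, in `u + 1` ways. -/
theorem opAppend_zero : opAppend 0 = opD * opZ := by
  refine LinearMap.ext fun f => egfCoeff_ext fun N => ?_
  rw [egfCoeff_opAppend, Module.End.mul_apply, egfCoeff_opD, egfCoeff_opZ_succ,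
    Finset.sum_eq_single (N, 0)]
  · rw [outputCount_zero]
  · rintro ⟨a, _ | b⟩ hp hne
    · rw [mem_antidiagonal] at hp
      exact absurd (by simpa using hp) (by simpa using hne)
    · rw [outputCount_zero_succ, zero_mul]
  · simp

/-- Decomposition of an appended output at its root. -/
theorem opD_sub_opAppend_mul (k : ℕ) :
    (opD - opAppend k) * opAppend (k + 1) = opD ^ 2 * opZ - opZ * opD := by
  refine LinearMap.ext fun f => egfCoeff_ext fun N => ?_
  simp only [Module.End.mul_apply, LinearMap.sub_apply, egfCoeff_sub, egfCoeff_opD, pow_two,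
    egfCoeff_opZ_opD, egfCoeff_opZ_succ]
  -- The split-off term is the appended terminal; it yields `D²z`.
  rw [egfCoeff_opAppend, Finset.Nat.sum_antidiagonal_succ', egfCoeff_opAppend]
  simp only [outputCount_zero, outputCount_succ_succ, egfCoeff_opAppend, sub_mul,
    Finset.sum_sub_distrib]
  -- Both sides sum over initial counter, left size and right size; the right side groups the first
  -- two into the counter met by the right graph.
  have htriple : ∑ p ∈ antidiagonal N, (∑ q ∈ antidiagonal p.2,
        outputCount (k + 1) q.1 p.1 * outputCount k q.2 (p.1 + q.1)) * egfCoeff p.1 f =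
      ∑ p ∈ antidiagonal N, outputCount k p.2 p.1 * ∑ q ∈ antidiagonal p.1,
        outputCount (k + 1) q.2 q.1 * egfCoeff q.1 f := by
    simp only [Finset.sum_mul, Finset.mul_sum]
    rw [Finset.sum_sigma', Finset.sum_sigma']
    refine Finset.sum_nbij' (fun x => ⟨(x.1.1 + x.2.1, x.2.2), (x.1.1, x.2.1)⟩)
      (fun x => ⟨(x.2.1, x.2.2 + x.1.2), (x.2.2, x.1.2)⟩) ?_ ?_ ?_ ?_ ?_
    · rintro ⟨⟨a, b⟩, c, d⟩ h
      simp only [Finset.mem_sigma, mem_antidiagonal] at h ⊢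
      exact ⟨by omega, trivial⟩
    · rintro ⟨⟨a, b⟩, c, d⟩ h
      simp only [Finset.mem_sigma, mem_antidiagonal] at h ⊢
      exact ⟨by omega, trivial⟩
    · rintro ⟨⟨a, b⟩, c, d⟩ h
      simp only [Finset.mem_sigma, mem_antidiagonal] at h
      obtain ⟨-, rfl⟩ := h
      rfl
    · rintro ⟨⟨a, b⟩, c, d⟩ h
      simp only [Finset.mem_sigma, mem_antidiagonal] at h
      obtain ⟨-, rfl⟩ := h
      rfl
    · rintro ⟨⟨a, b⟩, c, d⟩ -
      dsimp only
      ring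
  -- The recorded pairs contribute the term `zD`.
  have hcherry : ∑ p ∈ antidiagonal N, (if p.2 = 0 then (p.1 : ℚ) else 0) * egfCoeff p.1 f =
      N * egfCoeff N f := by
    rw [Finset.sum_eq_single (N, 0)]
    · simp
    · rintro ⟨a, b⟩ hp hne
      rw [mem_antidiagonal] at hp
      have hb : b ≠ 0 := by rintro rfl; exact hne (by simpa using hp)
      simp [hb]
    · simp
  rw [htriple, hcherry]
  push_cast
  ring

/-! ### Factorization of the operators -/

theorem opM_zero : opM 0 = opD - opAppend 0 := by
  rw [opAppend_zero, opM]
  refine LinearMap.ext fun f => egfCoeff_ext fun N => ?_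
  simp only [sub_mul, one_mul, Module.End.mul_apply, LinearMap.sub_apply, Module.End.one_apply,
    egfCoeff_sub, egfCoeff_opD, egfCoeff_opZ_opD, egfCoeff_opZ_succ]
  ring

theorem opM_one : opM 1 = opM 0 * opD - (opD ^ 2 * opZ - opZ * opD) := by
  rw [opM, opM]
  refine LinearMap.ext fun f => egfCoeff_ext fun N => ?_
  have h2 : (2 : Module.End ℚ (PowerSeries ℚ)) = 1 + 1 := by norm_num
  have h3 : (3 : Module.End ℚ (PowerSeries ℚ)) = 1 + 1 + 1 := by norm_num
  simp only [h2, h3, sub_mul, add_mul, one_mul, pow_two, Module.End.mul_apply,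
    LinearMap.sub_apply, LinearMap.add_apply, egfCoeff_sub, egfCoeff_add, egfCoeff_opD,
    egfCoeff_opZ_opD, egfCoeff_opZ_succ]
  push_cast
  ring

/-- Replacing `D²z - zD` by `(D - A_k) A_{k+1}` lets the previous factorization absorb `M_k (D -
A_{k+1})` into `M_{k+1}`, which then factors out on the left. -/
theorem opM_succ (k : ℕ) : opM (k + 1) = opM k * (opD - opAppend (k + 1)) := by
  induction k with
  | zero => rw [zero_add, opM_one, mul_sub, ← opD_sub_opAppend_mul 0, ← opM_zero]
  | succ k ih =>
    rw [opM, ← opD_sub_opAppend_mul (k + 1), ← mul_assoc, ← ih, ← mul_sub]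

/-- The series `1` encodes the initial counter `0`, and right height at most `k` means at most `k +
1` right levels. -/
theorem compactedEGF_eq (k : ℕ) : compactedEGF k = opAppend (k + 1) 1 := by
  refine egfCoeff_ext fun N => ?_
  rw [egfCoeff_opAppend, Finset.sum_eq_single (0, N)]
  · have h : ((N.factorial : ℕ) : ℚ) ≠ 0 := Nat.cast_ne_zero.2 N.factorial_ne_zero
    simp only [egfCoeff, compactedEGF, PowerSeries.coeff_mk, numCompactedTrees_eq]
    simp
    field_simp
  · rintro ⟨a, b⟩ hp hne
    rw [mem_antidiagonal] at hp
    have ha : a ≠ 0 := by rintro rfl; exact hne (by simpa using hp)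
    simp [egfCoeff, PowerSeries.coeff_one, ha]
  · simp

/-- Appending to the empty graph satisfies a homogeneous equation. -/
theorem opD_sub_opAppend_compactedEGF (k : ℕ) : (opD - opAppend k) (compactedEGF k) = 0 := by
  rw [compactedEGF_eq, ← Module.End.mul_apply, opD_sub_opAppend_mul]
  refine egfCoeff_ext fun N => ?_
  simp only [pow_two, Module.End.mul_apply, LinearMap.sub_apply, egfCoeff_sub, egfCoeff_opD,
    egfCoeff_opZ_opD, egfCoeff_opZ_succ]
  -- Here `D²z = 0` and `D 1 = 0`.
  cases N <;> simp [egfCoeff, PowerSeries.coeff_one]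

theorem theorem8p5 (k : ℕ) : opM k (compactedEGF k) = 0 := by
  cases k with
  | zero => rw [opM_zero, opD_sub_opAppend_compactedEGF]
  | succ k => rw [opM_succ, Module.End.mul_apply, opD_sub_opAppend_compactedEGF, map_zero]
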